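/- Let $n\ge 1$ and $d$ be natural numbers, let $\mu\in\mathbb{R}^d$, and let $X$ be a random $n\times d$ real matrix whose rows $X_1,\dots,X_n$ are independent random vectors, each with the Gaussian distribution $\mathcal{N}(\mu,I_d)$. Let $\bar\mu=\frac1n\sum_{i=1}^n X_i$ be the sample mean, and let $$\Sigma=\frac1n\sum_{i=1}^n (X_i-\bar\mu)^{T}(X_i-\bar\mu)=\frac1n (X-\bar\mu)^T(X-\bar\mu)$$ be the sample covariance matrix, where the $X_i$ and $\bar\mu$ are row vectors and $X-\bar\mu$ is the matrix obtained from $X$ by subtracting $\bar\mu$ from each row. Let $\|\Sigma\|_2$ denote the spectral (Euclidean operator) norm of $\Sigma$. Then for every $t>0$, with probability at least $1-3\exp(-t^2/2)$, $$\|\Sigma\|_2\le\left(1+\sqrt{\frac dn}+\frac{t}{\sqrt n}+\frac{\sqrt{d+\sqrt{2d}\,t+t^2}}{n}\right)^2 .$$ -/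

import Mathlib

open MeasureTheory ProbabilityTheory
open scoped Matrix Matrix.Norms.L2Operator

/-- The sample mean `(1/n) ∑ i, X i` of the rows of an `n × d` data matrix `X`. -/
noncomputable def sampleMean {n d : ℕ} (X : Matrix (Fin n) (Fin d) ℝ) : Fin d → ℝ :=
  fun j => (1 / (n : ℝ)) * ∑ i, X i j

/-- The data matrix with the sample mean subtracted from each row. -/
noncomputable def centeredData {n d : ℕ} (X : Matrix (Fin n) (Fin d) ℝ) :
    Matrix (Fin n) (Fin d) ℝ :=
  Matrix.of fun i j => X i j - sampleMean X j

/-- The sample covariance matrix `(1/n) Zᵀ Z`, where `Z` is the data matrix `X` centred at its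
sample mean. -/
noncomputable def sampleCovariance {n d : ℕ} (X : Matrix (Fin n) (Fin d) ℝ) :
    Matrix (Fin d) (Fin d) ℝ :=
  (1 / (n : ℝ)) • ((centeredData X)ᵀ * centeredData X)

/-! Centring is an orthogonal projection, so it cannot increase the operator norm: `‖Σ‖ ≤ ‖G‖² / n`,
where `G = X - μ` has independent standard normal entries. What remains is the Davidson–Szarek bound
`‖G‖ ≤ √n + √d + t` outside an event of probability `exp (-t²/2)` (`measureReal_lt_l2_opNorm_le`).
The fourth summand in the theorem and the factor 3 are slack.

That bound comes from comparing exponential moments, with no separate concentration inequality. For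
unit vectors, `uᵀGv + γ` (`γ` an independent standard normal) has the same variance 2 as `⟨g,u⟩ +
⟨h,v⟩`, and larger covariances because `(1 - u·u')(1 - v·v') ≥ 0`. Slepian interpolation
(`integral_expSum_rpow_le`) then compares the soft maxima `(∑ exp ((λ/p) wₖ·z))^p`, which lie
between `exp (λ max)` and `N^p exp (λ max)` for `N` forms; letting `p → 0` removes `N`. On the
additive side the maximum is at most `|g| + |h|`, and `E exp (λ|g|) ≤ exp (λ√m + λ²/2)` in dimension
`m`. On the bilinear side `γ` contributes exactly `exp (λ²/2)`. Chernoff at `λ = t` gives `exp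
(-t²/2)` (`measureReal_exists_lt_bilin_le`), and a countable dense set of pairs `(u,v)` recovers the
operator norm. -/

/-! ### Gaussian integration by parts -/

section GaussianCalculus

variable {ι κ : Type*} [Fintype ι] [Fintype κ]

/-- Stein's identity for the standard Gaussian measure on the line. -/
lemma integral_mul_gaussianReal_eq_integral_deriv {f f' : ℝ → ℝ}
    (hf : ∀ x, HasDerivAt f (f' x) x) (hfi : Integrable f (gaussianReal 0 1))
    (hxf : Integrable (fun x => x * f x) (gaussianReal 0 1))
    (hfi' : Integrable f' (gaussianReal 0 1)) :
    ∫ x, x * f x ∂(gaussianReal 0 1) = ∫ x, f' x ∂(gaussianReal 0 1) := by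
  have key : ∀ g : ℝ → ℝ, Integrable g (gaussianReal 0 1) →
      Integrable (fun x => gaussianPDFReal 0 1 x * g x) := by
    intro g hg
    rw [gaussianReal_of_var_ne_zero 0 one_ne_zero,
      integrable_withDensity_iff_integrable_smul' (by fun_prop)
        (Filter.Eventually.of_forall fun x => gaussianPDF_lt_top)] at hg
    simpa [toReal_gaussianPDF] using hg
  have hpdf : ∀ x, HasDerivAt (gaussianPDFReal 0 1) (-x * gaussianPDFReal 0 1 x) x := by
    intro x
    have h1 : HasDerivAt (fun x : ℝ => -x ^ 2 / 2) (-x) x := by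
      refine ((hasDerivAt_pow 2 x).neg.div_const 2).congr_deriv ?_
      ring
    have h2 := (h1.exp).const_mul ((√(2 * Real.pi))⁻¹)
    have h3 : gaussianPDFReal 0 1 = fun x => (√(2 * Real.pi))⁻¹ * Real.exp (-x ^ 2 / 2) := by
      ext y; simp [gaussianPDFReal]
    rw [h3]
    refine h2.congr_deriv ?_
    ring
  rw [integral_gaussianReal_eq_integral_smul one_ne_zero,
    integral_gaussianReal_eq_integral_smul one_ne_zero]
  have h := integral_mul_deriv_eq_deriv_mul_of_integrable (u := f) (u' := f')
    (v := gaussianPDFReal 0 1) (v' := fun x => -x * gaussianPDFReal 0 1 x)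
    (fun x _ => hf x) (fun x _ => hpdf x) ?_ ?_ ?_
  · simp only [smul_eq_mul]
    calc ∫ x, gaussianPDFReal 0 1 x * (x * f x)
        = -∫ x, f x * (-x * gaussianPDFReal 0 1 x) := by
          rw [← integral_neg]; congr 1; ext x; ring
      _ = ∫ x, f' x * gaussianPDFReal 0 1 x := by rw [h, neg_neg]
      _ = _ := by congr 1; ext x; ring
  · refine (key _ hxf).neg.congr (Filter.Eventually.of_forall fun x => ?_)
    simp only [Pi.neg_apply, Pi.mul_apply]; ring
  · refine (key _ hfi').congr (Filter.Eventually.of_forall fun x => ?_)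
    simp only [Pi.mul_apply]; ring
  · refine (key _ hfi).congr (Filter.Eventually.of_forall fun x => ?_)
    simp only [Pi.mul_apply]; ring

/-- Resampling one coordinate of a product probability measure preserves it. -/
lemma measurePreserving_update_pi [DecidableEq ι] (ν : Measure ℝ) [IsProbabilityMeasure ν] (i : ι) :
    MeasurePreserving (fun p : (ι → ℝ) × ℝ => Function.update p.1 i p.2)
      ((Measure.pi fun _ : ι => ν).prod ν) (Measure.pi fun _ : ι => ν) := by
  have hm : Measurable fun p : (ι → ℝ) × ℝ => Function.update p.1 i p.2 := by
    rw [measurable_pi_iff]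
    intro j
    by_cases h : j = i
    · subst h; simpa using measurable_snd
    · simp only [Function.update_of_ne h]; fun_prop
  refine ⟨hm, (Measure.pi_eq fun s hs => ?_).symm⟩
  rw [Measure.map_apply hm (MeasurableSet.univ_pi hs)]
  have : (fun p : (ι → ℝ) × ℝ => Function.update p.1 i p.2) ⁻¹' Set.univ.pi s
      = (Set.univ.pi (Function.update s i Set.univ)) ×ˢ s i := by
    ext ⟨z, t⟩
    simp only [Set.mem_preimage, Set.mem_univ_pi, Set.mem_prod]
    constructor
    · intro h
      refine ⟨fun j => ?_, by simpa using h i⟩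
      by_cases hj : j = i
      · subst hj; simp
      · simpa [hj] using h j
    · rintro ⟨h1, h2⟩ j
      by_cases hj : j = i
      · subst hj; simpa using h2
      · simpa [hj] using h1 j
  rw [this, Measure.prod_prod, Measure.pi_pi, ← Finset.prod_erase_mul _ _ (Finset.mem_univ i),
    ← Finset.prod_erase_mul _ (fun j => ν (s j)) (Finset.mem_univ i)]
  simp only [Function.update_self, measure_univ, mul_one]
  congr 1
  refine Finset.prod_congr rfl fun j hj => ?_
  rw [Function.update_of_ne (Finset.ne_of_mem_erase hj)]

lemma integral_pi_eq_integral_integral_update [DecidableEq ι] (ν : Measure ℝ)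
    [IsProbabilityMeasure ν] (i : ι) {F : (ι → ℝ) → ℝ}
    (hF : Integrable F (Measure.pi fun _ : ι => ν)) :
    ∫ z, F z ∂(Measure.pi fun _ : ι => ν)
      = ∫ z, ∫ t, F (Function.update z i t) ∂ν ∂(Measure.pi fun _ : ι => ν) := by
  have h := measurePreserving_update_pi ν i
  have h1 := h.integrable_comp_of_integrable hF
  rw [← h.map_eq, integral_map h.measurable.aemeasurable
    (by rw [h.map_eq]; exact hF.aestronglyMeasurable), h.map_eq]
  exact integral_prod _ h1

/-- Stein's identity for the standard Gaussian measure on a finite product. -/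
lemma integral_eval_mul_pi_gaussianReal [DecidableEq ι] (i : ι) {F F' : (ι → ℝ) → ℝ}
    (hF : ∀ z, HasDerivAt (fun t => F (Function.update z i t)) (F' z) (z i))
    (h0 : Integrable F (Measure.pi fun _ : ι => gaussianReal 0 1))
    (h1 : Integrable (fun z => z i * F z) (Measure.pi fun _ : ι => gaussianReal 0 1))
    (h2 : Integrable F' (Measure.pi fun _ : ι => gaussianReal 0 1)) :
    ∫ z, z i * F z ∂(Measure.pi fun _ : ι => gaussianReal 0 1)
      = ∫ z, F' z ∂(Measure.pi fun _ : ι => gaussianReal 0 1) := by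
  rw [integral_pi_eq_integral_integral_update _ i h1, integral_pi_eq_integral_integral_update _ i h2]
  have hp := measurePreserving_update_pi (gaussianReal 0 1) i
  refine integral_congr_ae ?_
  -- Fubini gives the one-variable integrability only for almost every `z`, which is enough under
  -- the outer integral.
  filter_upwards [(hp.integrable_comp_of_integrable h0).prod_right_ae,
    (hp.integrable_comp_of_integrable h1).prod_right_ae,
    (hp.integrable_comp_of_integrable h2).prod_right_ae] with z hz0 hz1 hz2
  simp only [Function.comp_def, Function.update_self] at hz0 hz1 hz2 ⊢
  refine integral_mul_gaussianReal_eq_integral_deriv (fun x => ?_) hz0 hz1 hz2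
  simpa using hF (Function.update z i x)

lemma integrable_exp_sum_abs_pi_gaussianReal (K : ℝ) :
    Integrable (fun z : ι → ℝ => Real.exp (K * ∑ i, |z i|))
      (Measure.pi fun _ : ι => gaussianReal 0 1) := by
  have h1 : Integrable (fun x : ℝ => Real.exp (K * |x|)) (gaussianReal 0 1) :=
    integrable_exp_mul_abs (integrable_exp_mul_gaussianReal K) (integrable_exp_mul_gaussianReal (-K))
  have := Integrable.fintype_prod (μ := fun _ : ι => gaussianReal 0 1)
    (f := fun _ x => Real.exp (K * |x|)) (fun _ => h1)
  refine this.congr (Filter.Eventually.of_forall fun z => ?_)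
  simp [Finset.mul_sum, Real.exp_sum]

lemma integrable_of_continuous_of_abs_le_exp {F : (ι → ℝ) → ℝ} (hF : Continuous F) (C K : ℝ)
    (hb : ∀ z, |F z| ≤ C * Real.exp (K * ∑ i, |z i|)) :
    Integrable F (Measure.pi fun _ : ι => gaussianReal 0 1) :=
  ((integrable_exp_sum_abs_pi_gaussianReal K).const_mul C).mono' hF.aestronglyMeasurable
    (Filter.Eventually.of_forall fun z => hb z)

end GaussianCalculus

/-! ### The soft maximum: domination, integrability and Stein's identity -/

section Comparison

variable {ι κ : Type*} [Fintype ι] [Fintype κ]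

/-- The sum of the exponentials of `β` times the linear forms `z ↦ w k ⬝ᵥ z`. -/
noncomputable def expSum (β : ℝ) (w : κ → ι → ℝ) (z : ι → ℝ) : ℝ :=
  ∑ k, Real.exp (β * (w k ⬝ᵥ z))

lemma expSum_pos [Nonempty κ] (β : ℝ) (w : κ → ι → ℝ) (z : ι → ℝ) : 0 < expSum β w z :=
  Finset.sum_pos (fun _ _ => Real.exp_pos _) Finset.univ_nonempty

lemma exp_le_expSum (β : ℝ) (w : κ → ι → ℝ) (z : ι → ℝ) (k : κ) :
    Real.exp (β * (w k ⬝ᵥ z)) ≤ expSum β w z :=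
  Finset.single_le_sum (f := fun k => Real.exp (β * (w k ⬝ᵥ z)))
    (fun _ _ => (Real.exp_pos _).le) (Finset.mem_univ k)

lemma continuous_expSum (β : ℝ) (w : κ → ι → ℝ) : Continuous (expSum β w) := by
  unfold expSum dotProduct
  fun_prop

lemma continuous_expSum_rpow [Nonempty κ] (β q : ℝ) (w : κ → ι → ℝ) :
    Continuous fun z => expSum β w z ^ q :=
  (continuous_expSum β w).rpow_const fun z => Or.inl (expSum_pos β w z).ne'

lemma abs_dotProduct_le_norm_mul_sum_abs (c z : ι → ℝ) : |c ⬝ᵥ z| ≤ ‖c‖ * ∑ i, |z i| := by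
  unfold dotProduct
  refine (Finset.abs_sum_le_sum_abs _ _).trans ?_
  rw [Finset.mul_sum]
  refine Finset.sum_le_sum fun i _ => ?_
  rw [abs_mul]
  exact mul_le_mul_of_nonneg_right (norm_le_pi_norm c i) (abs_nonneg _)

lemma exp_mul_dotProduct_le (w : κ → ι → ℝ) (z : ι → ℝ) (k : κ) {q M : ℝ} (hq : 0 ≤ q)
    (hM : ‖w‖ ≤ M) :
    Real.exp (q * (w k ⬝ᵥ z)) ≤ Real.exp (q * M * ∑ i, |z i|) := by
  rw [Real.exp_le_exp, mul_assoc]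
  refine mul_le_mul_of_nonneg_left ?_ hq
  calc w k ⬝ᵥ z ≤ ‖w k‖ * ∑ i, |z i| := (le_abs_self _).trans (abs_dotProduct_le_norm_mul_sum_abs _ _)
    _ ≤ M * ∑ i, |z i| := mul_le_mul_of_nonneg_right ((norm_le_pi_norm w k).trans hM)
      (Finset.sum_nonneg fun _ _ => abs_nonneg _)

/-- Since `p - 1 ≤ 0`, the sum in the negative power may be replaced by its `k`-th term, leaving
`exp (pβ wₖ·z)`. Uniformity over `‖w‖ ≤ M` is what differentiation under the integral needs. -/
lemma exp_mul_expSum_rpow_le [Nonempty κ] (w : κ → ι → ℝ) (z : ι → ℝ) (k : κ) {β p M : ℝ}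
    (hβ : 0 ≤ β) (hp0 : 0 ≤ p) (hp1 : p ≤ 1) (hM : ‖w‖ ≤ M) :
    Real.exp (β * (w k ⬝ᵥ z)) * expSum β w z ^ (p - 1) ≤ Real.exp (p * β * M * ∑ i, |z i|) := by
  calc Real.exp (β * (w k ⬝ᵥ z)) * expSum β w z ^ (p - 1)
      ≤ Real.exp (β * (w k ⬝ᵥ z)) * Real.exp (β * (w k ⬝ᵥ z)) ^ (p - 1) := by
        refine mul_le_mul_of_nonneg_left ?_ (Real.exp_pos _).le
        exact Real.rpow_le_rpow_of_nonpos (Real.exp_pos _) (exp_le_expSum β w z k) (by linarith)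
    _ = Real.exp (p * β * (w k ⬝ᵥ z)) := by
        rw [← Real.exp_mul, ← Real.exp_add]; congr 1; ring
    _ ≤ _ := exp_mul_dotProduct_le w z k (mul_nonneg hp0 hβ) hM

lemma exp_mul_exp_mul_expSum_rpow_le [Nonempty κ] (w : κ → ι → ℝ) (z : ι → ℝ) (k l : κ)
    {β p M : ℝ} (hβ : 0 ≤ β) (hp0 : 0 ≤ p) (hp1 : p ≤ 1) (hM : ‖w‖ ≤ M) :
    Real.exp (β * (w k ⬝ᵥ z)) * Real.exp (β * (w l ⬝ᵥ z)) * expSum β w z ^ (p - 2)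
      ≤ Real.exp (p * β * M * ∑ i, |z i|) := by
  refine le_trans ?_ (exp_mul_expSum_rpow_le w z k hβ hp0 hp1 hM)
  have h : expSum β w z ^ (p - 1) = expSum β w z * expSum β w z ^ (p - 2) := by
    nth_rewrite 2 [← Real.rpow_one (expSum β w z)]
    rw [← Real.rpow_add (expSum_pos β w z)]
    congr 1; ring
  rw [h, mul_assoc]
  refine mul_le_mul_of_nonneg_left ?_ (Real.exp_pos _).le
  exact mul_le_mul_of_nonneg_right (exp_le_expSum β w z l)
    (Real.rpow_nonneg (expSum_pos β w z).le _)

lemma expSum_rpow_eq_sum [Nonempty κ] (β p : ℝ) (w : κ → ι → ℝ) (z : ι → ℝ) :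
    expSum β w z ^ p = ∑ k, Real.exp (β * (w k ⬝ᵥ z)) * expSum β w z ^ (p - 1) := by
  rw [← Finset.sum_mul]
  change _ = expSum β w z * _
  nth_rewrite 2 [← Real.rpow_one (expSum β w z)]
  rw [← Real.rpow_add (expSum_pos β w z)]
  congr 1; ring

lemma continuous_exp_mul_dotProduct (β : ℝ) (c : ι → ℝ) :
    Continuous fun z : ι → ℝ => Real.exp (β * (c ⬝ᵥ z)) := by
  unfold dotProduct
  fun_prop

lemma abs_le_sum_abs (z : ι → ℝ) (i : ι) : |z i| ≤ ∑ j, |z j| :=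
  Finset.single_le_sum (f := fun j => |z j|) (fun _ _ => abs_nonneg _) (Finset.mem_univ i)

variable [Nonempty κ] {β p : ℝ}

lemma integrable_exp_mul_expSum_rpow (w : κ → ι → ℝ) (k : κ) (hβ : 0 ≤ β) (hp0 : 0 ≤ p)
    (hp1 : p ≤ 1) :
    Integrable (fun z => Real.exp (β * (w k ⬝ᵥ z)) * expSum β w z ^ (p - 1))
      (Measure.pi fun _ : ι => gaussianReal 0 1) := by
  refine integrable_of_continuous_of_abs_le_exp
    ((continuous_exp_mul_dotProduct β (w k)).mul (continuous_expSum_rpow β _ w)) 1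
    (p * β * ‖w‖) fun z => ?_
  rw [one_mul, abs_of_nonneg (mul_nonneg (Real.exp_pos _).le
    (Real.rpow_nonneg (expSum_pos β w z).le _))]
  exact exp_mul_expSum_rpow_le w z k hβ hp0 hp1 le_rfl

lemma integrable_eval_mul_exp_mul_expSum_rpow (w : κ → ι → ℝ) (k : κ) (i : ι) (hβ : 0 ≤ β)
    (hp0 : 0 ≤ p) (hp1 : p ≤ 1) :
    Integrable (fun z => z i * (Real.exp (β * (w k ⬝ᵥ z)) * expSum β w z ^ (p - 1)))
      (Measure.pi fun _ : ι => gaussianReal 0 1) := by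
  refine integrable_of_continuous_of_abs_le_exp ((continuous_apply i).mul
    ((continuous_exp_mul_dotProduct β (w k)).mul (continuous_expSum_rpow β _ w))) 1
    (1 + p * β * ‖w‖) fun z => ?_
  rw [one_mul, abs_mul, abs_of_nonneg (a := _ * _) (mul_nonneg (Real.exp_pos _).le
    (Real.rpow_nonneg (expSum_pos β w z).le _)), add_mul, Real.exp_add]
  refine mul_le_mul ?_ (exp_mul_expSum_rpow_le w z k hβ hp0 hp1 le_rfl)
    (mul_nonneg (Real.exp_pos _).le (Real.rpow_nonneg (expSum_pos β w z).le _))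
    (Real.exp_pos _).le
  have := Real.add_one_le_exp (1 * ∑ i, |z i|)
  have := abs_le_sum_abs z i
  linarith

lemma integrable_exp_mul_exp_mul_expSum_rpow (w : κ → ι → ℝ) (k l : κ) (hβ : 0 ≤ β)
    (hp0 : 0 ≤ p) (hp1 : p ≤ 1) :
    Integrable (fun z => Real.exp (β * (w k ⬝ᵥ z)) * Real.exp (β * (w l ⬝ᵥ z)) *
      expSum β w z ^ (p - 2)) (Measure.pi fun _ : ι => gaussianReal 0 1) := by
  refine integrable_of_continuous_of_abs_le_exp
    (((continuous_exp_mul_dotProduct β (w k)).mul (continuous_exp_mul_dotProduct β (w l))).mul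
      (continuous_expSum_rpow β _ w)) 1 (p * β * ‖w‖) fun z => ?_
  rw [one_mul, abs_of_nonneg (mul_nonneg (mul_nonneg (Real.exp_pos _).le (Real.exp_pos _).le)
    (Real.rpow_nonneg (expSum_pos β w z).le _))]
  exact exp_mul_exp_mul_expSum_rpow_le w z k l hβ hp0 hp1 le_rfl

lemma integrable_expSum_rpow (w : κ → ι → ℝ) (hβ : 0 ≤ β) (hp0 : 0 ≤ p) (hp1 : p ≤ 1) :
    Integrable (fun z => expSum β w z ^ p) (Measure.pi fun _ : ι => gaussianReal 0 1) := by
  simp only [expSum_rpow_eq_sum β p w]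
  exact integrable_finsetSum _ fun k _ => integrable_exp_mul_expSum_rpow w k hβ hp0 hp1

lemma hasDerivAt_dotProduct_update [DecidableEq ι] (c z : ι → ℝ) (i : ι) :
    HasDerivAt (fun t => c ⬝ᵥ Function.update z i t) (c i) (z i) := by
  have h : (fun t => c ⬝ᵥ Function.update z i t)
      = fun t => c i * t + ∑ j ∈ Finset.univ.erase i, c j * z j := by
    ext t
    unfold dotProduct
    rw [← Finset.add_sum_erase _ _ (Finset.mem_univ i), Function.update_self]
    congr 1
    refine Finset.sum_congr rfl fun j hj => ?_
    rw [Function.update_of_ne (Finset.ne_of_mem_erase hj)]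
  rw [h]
  exact (((hasDerivAt_id' (z i)).const_mul (c i)).congr_deriv (mul_one _)).add_const _

/-- Stein's identity in coordinate `i`: the first term differentiates the exponential, the sum over
`l` the power. The factor `p - 1` later fixes the sign in the comparison. -/
lemma integral_eval_mul_exp_mul_expSum_rpow (w : κ → ι → ℝ) (k : κ) (i : ι) (hβ : 0 ≤ β)
    (hp0 : 0 ≤ p) (hp1 : p ≤ 1) :
    ∫ z, z i * (Real.exp (β * (w k ⬝ᵥ z)) * expSum β w z ^ (p - 1))
        ∂(Measure.pi fun _ : ι => gaussianReal 0 1)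
      = β * w k i * ∫ z, Real.exp (β * (w k ⬝ᵥ z)) * expSum β w z ^ (p - 1)
          ∂(Measure.pi fun _ : ι => gaussianReal 0 1)
        + ∑ l, (p - 1) * β * w l i *
          ∫ z, Real.exp (β * (w k ⬝ᵥ z)) * Real.exp (β * (w l ⬝ᵥ z)) * expSum β w z ^ (p - 2)
            ∂(Measure.pi fun _ : ι => gaussianReal 0 1) := by
  classical
  have hI1 := (integrable_exp_mul_expSum_rpow w k hβ hp0 hp1).const_mul (β * w k i)
  have hI2 := fun l => (integrable_exp_mul_exp_mul_expSum_rpow w k l hβ hp0 hp1).const_mul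
    ((p - 1) * β * w l i)
  have hI3 := integrable_finsetSum Finset.univ fun l _ => hI2 l
  rw [integral_eval_mul_pi_gaussianReal i (F' := fun z =>
      β * w k i * (Real.exp (β * (w k ⬝ᵥ z)) * expSum β w z ^ (p - 1))
      + ∑ l, (p - 1) * β * w l i *
        (Real.exp (β * (w k ⬝ᵥ z)) * Real.exp (β * (w l ⬝ᵥ z)) * expSum β w z ^ (p - 2)))
    (fun z => ?_) (integrable_exp_mul_expSum_rpow w k hβ hp0 hp1)
    (integrable_eval_mul_exp_mul_expSum_rpow w k i hβ hp0 hp1) (hI1.add hI3),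
    integral_add hI1 hI3, integral_finsetSum _ fun l _ => hI2 l, integral_const_mul]
  · simp only [integral_const_mul]
  · have he : ∀ l, HasDerivAt (fun t => Real.exp (β * (w l ⬝ᵥ Function.update z i t)))
        (Real.exp (β * (w l ⬝ᵥ z)) * (β * w l i)) (z i) := fun l => by
      simpa using ((hasDerivAt_dotProduct_update (w l) z i).const_mul β).exp
    have hS : HasDerivAt (fun t => expSum β w (Function.update z i t))
        (∑ l, Real.exp (β * (w l ⬝ᵥ z)) * (β * w l i)) (z i) :=
      HasDerivAt.fun_sum fun l _ => he l
    have hSp := hS.rpow_const (p := p - 1) (Or.inl (expSum_pos β w _).ne')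
    refine ((he k).mul hSp).congr_deriv ?_
    simp only [Function.update_eq_self]
    rw [show p - 1 - 1 = p - 2 by ring, Finset.sum_mul, Finset.sum_mul, Finset.mul_sum]
    congr 1
    · ring
    · exact Finset.sum_congr rfl fun l _ => by ring

lemma integral_dotProduct_mul_exp_mul_expSum_rpow (w : κ → ι → ℝ) (c : ι → ℝ) (k : κ)
    (hβ : 0 ≤ β) (hp0 : 0 ≤ p) (hp1 : p ≤ 1) :
    ∫ z, (c ⬝ᵥ z) * (Real.exp (β * (w k ⬝ᵥ z)) * expSum β w z ^ (p - 1))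
        ∂(Measure.pi fun _ : ι => gaussianReal 0 1)
      = β * (c ⬝ᵥ w k) * ∫ z, Real.exp (β * (w k ⬝ᵥ z)) * expSum β w z ^ (p - 1)
          ∂(Measure.pi fun _ : ι => gaussianReal 0 1)
        + ∑ l, (p - 1) * β * (c ⬝ᵥ w l) *
          ∫ z, Real.exp (β * (w k ⬝ᵥ z)) * Real.exp (β * (w l ⬝ᵥ z)) * expSum β w z ^ (p - 2)
            ∂(Measure.pi fun _ : ι => gaussianReal 0 1) := by
  have h : ∀ z, (c ⬝ᵥ z) * (Real.exp (β * (w k ⬝ᵥ z)) * expSum β w z ^ (p - 1))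
      = ∑ i, c i * (z i * (Real.exp (β * (w k ⬝ᵥ z)) * expSum β w z ^ (p - 1))) := fun z => by
    nth_rewrite 1 [dotProduct]
    rw [Finset.sum_mul]
    exact Finset.sum_congr rfl fun i _ => by ring
  simp only [h]
  rw [integral_finsetSum _ fun i _ =>
    (integrable_eval_mul_exp_mul_expSum_rpow w k i hβ hp0 hp1).const_mul (c i)]
  simp only [integral_const_mul, integral_eval_mul_exp_mul_expSum_rpow w k _ hβ hp0 hp1, mul_add,
    Finset.sum_add_distrib, Finset.mul_sum]
  congr 1
  · rw [show c ⬝ᵥ w k = ∑ i, c i * w k i from rfl]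
    rw [Finset.mul_sum, Finset.sum_mul]
    exact Finset.sum_congr rfl fun i _ => by ring
  · rw [Finset.sum_comm]
    refine Finset.sum_congr rfl fun l _ => ?_
    rw [show c ⬝ᵥ w l = ∑ i, c i * w l i from rfl]
    rw [Finset.mul_sum, Finset.sum_mul]
    exact Finset.sum_congr rfl fun i _ => by ring

end Comparison

/-! ### Slepian interpolation -/

section Interpolation

variable {ι κ : Type*} [Fintype ι] [Fintype κ]

lemma norm_sin_smul_add_cos_smul_le {E : Type*} [NormedAddCommGroup E] [NormedSpace ℝ E]
    (a b : E) (θ : ℝ) : ‖Real.sin θ • a + Real.cos θ • b‖ ≤ ‖a‖ + ‖b‖ := by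
  refine (norm_add_le _ _).trans (add_le_add ?_ ?_) <;> rw [norm_smul]
  · exact mul_le_of_le_one_left (norm_nonneg _) (Real.abs_sin_le_one θ)
  · exact mul_le_of_le_one_left (norm_nonneg _) (Real.abs_cos_le_one θ)

lemma norm_cos_smul_sub_sin_smul_le {E : Type*} [NormedAddCommGroup E] [NormedSpace ℝ E]
    (a b : E) (θ : ℝ) : ‖Real.cos θ • a - Real.sin θ • b‖ ≤ ‖a‖ + ‖b‖ := by
  refine (norm_sub_le _ _).trans (add_le_add ?_ ?_) <;> rw [norm_smul]
  · exact mul_le_of_le_one_left (norm_nonneg _) (Real.abs_cos_le_one θ)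
  · exact mul_le_of_le_one_left (norm_nonneg _) (Real.abs_sin_le_one θ)

/-- Coefficients along the rotation have norm at most `‖a‖ + ‖b‖`, so one dominating function serves
all `θ`; the extra `1` in its exponent absorbs the linear factor in `z`. -/
lemma hasDerivAt_integral_expSum_rpow [Nonempty κ] {β p : ℝ} (hβ : 0 ≤ β) (hp0 : 0 ≤ p)
    (hp1 : p ≤ 1) (a b : κ → ι → ℝ) (θ : ℝ) :
    HasDerivAt (fun θ => ∫ z, expSum β (Real.sin θ • a + Real.cos θ • b) z ^ p
        ∂(Measure.pi fun _ : ι => gaussianReal 0 1))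
      (∫ z, ∑ k, p * β * (((Real.cos θ • a k - Real.sin θ • b k) ⬝ᵥ z) *
        (Real.exp (β * ((Real.sin θ • a + Real.cos θ • b) k ⬝ᵥ z)) *
          expSum β (Real.sin θ • a + Real.cos θ • b) z ^ (p - 1)))
        ∂(Measure.pi fun _ : ι => gaussianReal 0 1)) θ := by
  refine (hasDerivAt_integral_of_dominated_loc_of_deriv_le
    (F' := fun θ z => ∑ k, p * β * (((Real.cos θ • a k - Real.sin θ • b k) ⬝ᵥ z) *
        (Real.exp (β * ((Real.sin θ • a + Real.cos θ • b) k ⬝ᵥ z)) *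
          expSum β (Real.sin θ • a + Real.cos θ • b) z ^ (p - 1))))
    (bound := fun z => ∑ _k : κ, p * β * (‖a‖ + ‖b‖) *
      Real.exp ((1 + p * β * (‖a‖ + ‖b‖)) * ∑ i, |z i|))
    Filter.univ_mem (Filter.Eventually.of_forall fun θ =>
      (continuous_expSum_rpow β p _).aestronglyMeasurable)
    (integrable_expSum_rpow _ hβ hp0 hp1) ?_ ?_ ?_ ?_).2
  · refine Continuous.aestronglyMeasurable ?_
    refine continuous_finsetSum _ fun k _ => continuous_const.mul (Continuous.mul ?_
      ((continuous_exp_mul_dotProduct β _).mul (continuous_expSum_rpow β _ _)))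
    unfold dotProduct
    fun_prop
  · refine Filter.Eventually.of_forall fun z θ _ => (norm_sum_le _ _).trans
      (Finset.sum_le_sum fun k _ => ?_)
    have hM : ‖Real.cos θ • a k - Real.sin θ • b k‖ ≤ ‖a‖ + ‖b‖ :=
      (norm_cos_smul_sub_sin_smul_le _ _ _).trans
        (add_le_add (norm_le_pi_norm a k) (norm_le_pi_norm b k))
    have hN : 0 ≤ ∑ i, |z i| := Finset.sum_nonneg fun _ _ => abs_nonneg _
    have h0 : 0 ≤ ‖a‖ + ‖b‖ := by positivity
    rw [norm_mul (p * β), norm_mul (_ ⬝ᵥ z), Real.norm_of_nonneg (mul_nonneg hp0 hβ), mul_assoc (p * β),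
      Real.norm_of_nonneg (mul_nonneg (Real.exp_pos _).le
        (Real.rpow_nonneg (expSum_pos β _ z).le _)), add_mul 1, Real.exp_add, ← mul_assoc (‖a‖ + ‖b‖)]
    refine mul_le_mul_of_nonneg_left (mul_le_mul ?_
      (exp_mul_expSum_rpow_le _ z k hβ hp0 hp1 (norm_sin_smul_add_cos_smul_le a b θ))
      (mul_nonneg (Real.exp_pos _).le (Real.rpow_nonneg (expSum_pos β _ z).le _))
      (mul_nonneg h0 (Real.exp_pos _).le)) (mul_nonneg hp0 hβ)
    refine (abs_dotProduct_le_norm_mul_sum_abs _ _).trans (mul_le_mul hM ?_ hN h0)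
    have := Real.add_one_le_exp (1 * ∑ i, |z i|)
    linarith
  · exact integrable_finsetSum _ fun k _ => (integrable_exp_sum_abs_pi_gaussianReal _).const_mul _
  · refine Filter.Eventually.of_forall fun z θ _ => ?_
    have hd : ∀ k, HasDerivAt (fun θ => (Real.sin θ • a + Real.cos θ • b) k ⬝ᵥ z)
        ((Real.cos θ • a k - Real.sin θ • b k) ⬝ᵥ z) θ := fun k => by
      simp only [Pi.add_apply, Pi.smul_apply, add_dotProduct, sub_dotProduct, smul_dotProduct,
        smul_eq_mul]
      refine (((Real.hasDerivAt_sin θ).mul_const (a k ⬝ᵥ z)).add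
        ((Real.hasDerivAt_cos θ).mul_const (b k ⬝ᵥ z))).congr_deriv ?_
      ring
    have hS : HasDerivAt (fun θ => expSum β (Real.sin θ • a + Real.cos θ • b) z)
        (∑ k, Real.exp (β * ((Real.sin θ • a + Real.cos θ • b) k ⬝ᵥ z)) *
          (β * ((Real.cos θ • a k - Real.sin θ • b k) ⬝ᵥ z))) θ :=
      HasDerivAt.fun_sum fun k _ => ((hd k).const_mul β).exp
    refine (hS.rpow_const (p := p) (Or.inl (expSum_pos β _ z).ne')).congr_deriv ?_
    rw [Finset.sum_mul, Finset.sum_mul]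
    exact Finset.sum_congr rfl fun k _ => by ring

lemma integrable_dotProduct_mul_exp_mul_expSum_rpow [Nonempty κ] {β p : ℝ} (w : κ → ι → ℝ)
    (c : ι → ℝ) (k : κ) (hβ : 0 ≤ β) (hp0 : 0 ≤ p) (hp1 : p ≤ 1) :
    Integrable (fun z => (c ⬝ᵥ z) * (Real.exp (β * (w k ⬝ᵥ z)) * expSum β w z ^ (p - 1)))
      (Measure.pi fun _ : ι => gaussianReal 0 1) := by
  have h : ∀ z, (c ⬝ᵥ z) * (Real.exp (β * (w k ⬝ᵥ z)) * expSum β w z ^ (p - 1))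
      = ∑ i, c i * (z i * (Real.exp (β * (w k ⬝ᵥ z)) * expSum β w z ^ (p - 1))) := fun z => by
    nth_rewrite 1 [dotProduct]
    rw [Finset.sum_mul]
    exact Finset.sum_congr rfl fun i _ => by ring
  simp only [h]
  exact integrable_finsetSum _ fun i _ =>
    (integrable_eval_mul_exp_mul_expSum_rpow _ k i hβ hp0 hp1).const_mul _

/-- Slepian-type comparison: if two centred Gaussian families have the same variances and the first
has the larger covariances, then the soft maximum of the first has the smaller exponential
moments. -/
theorem integral_expSum_rpow_le [Nonempty κ] {β p : ℝ} (hβ : 0 ≤ β) (hp0 : 0 ≤ p)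
    (hp1 : p ≤ 1) (a b : κ → ι → ℝ) (horth : ∀ k l, a k ⬝ᵥ b l = 0)
    (hvar : ∀ k, a k ⬝ᵥ a k = b k ⬝ᵥ b k) (hcov : ∀ k l, b k ⬝ᵥ b l ≤ a k ⬝ᵥ a l) :
    ∫ z, expSum β a z ^ p ∂(Measure.pi fun _ : ι => gaussianReal 0 1)
      ≤ ∫ z, expSum β b z ^ p ∂(Measure.pi fun _ : ι => gaussianReal 0 1) := by
  -- The rotation runs from `b` at `θ = 0` to `a` at `θ = π/2`, so the claim is that `φ` decreases.
  set φ : ℝ → ℝ := fun θ => ∫ z, expSum β (Real.sin θ • a + Real.cos θ • b) z ^ p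
        ∂(Measure.pi fun _ : ι => gaussianReal 0 1) with hφ
  have hder := hasDerivAt_integral_expSum_rpow hβ hp0 hp1 a b
  have hanti : AntitoneOn φ (Set.Icc 0 (Real.pi / 2)) := by
    refine antitoneOn_of_deriv_nonpos (convex_Icc _ _)
      (fun θ _ => (hder θ).continuousAt.continuousWithinAt)
      (fun θ _ => (hder θ).differentiableAt.differentiableWithinAt) fun θ hθ => ?_
    rw [interior_Icc] at hθ
    have hs : 0 ≤ Real.sin θ :=
      Real.sin_nonneg_of_nonneg_of_le_pi hθ.1.le (by linarith [hθ.2, Real.pi_pos])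
    have hc : 0 ≤ Real.cos θ := Real.cos_nonneg_of_mem_Icc ⟨by linarith [hθ.1, Real.pi_pos], hθ.2.le⟩
    have hinner : ∀ k l, (Real.cos θ • a k - Real.sin θ • b k) ⬝ᵥ
        (Real.sin θ • a + Real.cos θ • b) l
          = Real.sin θ * Real.cos θ * (a k ⬝ᵥ a l - b k ⬝ᵥ b l) := fun k l => by
      simp only [Pi.add_apply, Pi.smul_apply, sub_dotProduct, dotProduct_add, smul_dotProduct,
        dotProduct_smul, smul_eq_mul, horth, dotProduct_comm (b k) (a l)]
      ring
    have hint : ∀ k, Integrable (fun z => ((Real.cos θ • a k - Real.sin θ • b k) ⬝ᵥ z) *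
        (Real.exp (β * ((Real.sin θ • a + Real.cos θ • b) k ⬝ᵥ z)) *
          expSum β (Real.sin θ • a + Real.cos θ • b) z ^ (p - 1)))
        (Measure.pi fun _ : ι => gaussianReal 0 1) :=
      fun k => integrable_dotProduct_mul_exp_mul_expSum_rpow _ _ k hβ hp0 hp1
    rw [(hder θ).deriv, integral_finsetSum _ fun k _ => (hint k).const_mul _]
    refine Finset.sum_nonpos fun k _ => ?_
    rw [integral_const_mul, integral_dotProduct_mul_exp_mul_expSum_rpow _ _ k hβ hp0 hp1]
    refine mul_nonpos_of_nonneg_of_nonpos (mul_nonneg hp0 hβ) ?_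
    -- Equal variances kill the term without the factor `p - 1`; the rest has the sign of `p - 1 ≤
    -- 0`.
    rw [hinner, hvar, sub_self, mul_zero, mul_zero, zero_mul, zero_add]
    refine Finset.sum_nonpos fun l _ => mul_nonpos_of_nonpos_of_nonneg ?_
      (integral_nonneg fun z => mul_nonneg (mul_nonneg (Real.exp_pos _).le (Real.exp_pos _).le)
        (Real.rpow_nonneg (expSum_pos β _ z).le _))
    rw [hinner]
    exact mul_nonpos_of_nonpos_of_nonneg
      (mul_nonpos_of_nonpos_of_nonneg (by linarith) hβ)
      (mul_nonneg (mul_nonneg hs hc) (sub_nonneg.2 (hcov k l)))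
  have h := hanti (Set.left_mem_Icc.2 (by positivity)) (Set.right_mem_Icc.2 (by positivity))
    (by positivity : (0 : ℝ) ≤ Real.pi / 2)
  simpa [hφ] using h

end Interpolation

/-! ### Exponential moments of the norm of a Gaussian vector -/

section ChiMoments

lemma gaussianPDFReal_mul_exp_mul_sq (s x : ℝ) :
    gaussianPDFReal 0 1 x * Real.exp (s * x ^ 2)
      = (√(2 * Real.pi))⁻¹ * Real.exp (-(1 / 2 - s) * x ^ 2) := by
  simp only [gaussianPDFReal, NNReal.coe_one, mul_one, sub_zero]
  rw [mul_assoc, ← Real.exp_add]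
  congr 2
  ring

lemma integrable_exp_mul_sq_gaussianReal {s : ℝ} (hs : s < 1 / 2) :
    Integrable (fun x => Real.exp (s * x ^ 2)) (gaussianReal 0 1) := by
  rw [gaussianReal_of_var_ne_zero 0 one_ne_zero,
    integrable_withDensity_iff_integrable_smul' (by fun_prop)
      (Filter.Eventually.of_forall fun x => gaussianPDF_lt_top)]
  simp only [toReal_gaussianPDF, smul_eq_mul, gaussianPDFReal_mul_exp_mul_sq]
  exact (integrable_exp_neg_mul_sq (by linarith)).const_mul _

lemma integral_exp_mul_sq_gaussianReal {s : ℝ} (hs : s < 1 / 2) :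
    ∫ x, Real.exp (s * x ^ 2) ∂(gaussianReal 0 1) = √(1 / (1 - 2 * s)) := by
  rw [integral_gaussianReal_eq_integral_smul one_ne_zero]
  simp only [smul_eq_mul, gaussianPDFReal_mul_exp_mul_sq]
  rw [integral_const_mul, integral_gaussian, ← Real.sqrt_inv, ← Real.sqrt_mul (by positivity)]
  congr 1
  have h1 : (1 : ℝ) / 2 - s ≠ 0 := by linarith
  have h2 : (1 : ℝ) - 2 * s ≠ 0 := by linarith
  field_simp

/-- By `|g| ≤ c/2 + |g|²/(2c)`, the left side bounds `E exp (λ|g|)` for a standard Gaussian `g` in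
dimension `m`; `c` is then optimised. -/
lemma exists_exp_mul_sqrt_pow_le {lam : ℝ} (hl : 0 < lam) {m : ℕ} (hm : 0 < m) :
    ∃ c, lam < c ∧ Real.exp (lam * c / 2) * √(1 / (1 - 2 * (lam / (2 * c)))) ^ m
      ≤ Real.exp (lam * √m + lam ^ 2 / 2) := by
  set r : ℝ := √m with hr
  have hr0 : 0 < r := Real.sqrt_pos.2 (by exact_mod_cast hm)
  have hrm : r ^ 2 = m := Real.sq_sqrt (Nat.cast_nonneg m)
  have hD : lam < √(lam ^ 2 + 4 * r ^ 2) := Real.lt_sqrt_of_sq_lt (by nlinarith)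
  have hD2 : √(lam ^ 2 + 4 * r ^ 2) ^ 2 = lam ^ 2 + 4 * r ^ 2 := Real.sq_sqrt (by positivity)
  set D := √(lam ^ 2 + 4 * r ^ 2)
  -- The positive root of `c(c - λ) = m`, which minimises the left side over `c > λ`.
  obtain ⟨c, hc⟩ : ∃ c, c = (lam + D) / 2 := ⟨_, rfl⟩
  have hlc : lam < c := by rw [hc]; linarith
  have hc0 : 0 < c := hl.trans hlc
  have hcr : c * (c - lam) = r ^ 2 := by rw [hc]; linear_combination hD2 / 4
  refine ⟨c, hlc, ?_⟩
  have hsq : √(1 / (1 - 2 * (lam / (2 * c)))) = c / r := by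
    rw [← Real.sqrt_sq (div_pos hc0 hr0).le]
    congr 1
    rw [div_pow, ← hcr]
    have : c - lam ≠ 0 := by linarith
    have h3 : 1 - 2 * (lam / (2 * c)) = (c - lam) / c := by field_simp
    rw [h3]
    field_simp
  have hcr0 : 0 < c / r := div_pos hc0 hr0
  rw [hsq, ← Real.exp_log (pow_pos hcr0 m), ← Real.exp_add, Real.exp_le_exp, Real.log_pow, ← hrm]
  -- After `log x ≤ x - 1`, the remaining gap is exactly `(r - (c - λ))² / 2`.
  have hlog := mul_le_mul_of_nonneg_left (Real.log_le_sub_one_of_pos hcr0) (sq_nonneg r)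
  have h4 : r ^ 2 * (c / r - 1) = r * c - r ^ 2 := by field_simp
  nlinarith [sq_nonneg (r - (c - lam))]

end ChiMoments

/-! ### The bilinear and additive Gaussian families -/

section Bilinear

variable {m n κ : Type*} [Fintype m] [Fintype n]

lemma dotProduct_le_of_dotProduct_self_eq_one {u v : m → ℝ} (hu : u ⬝ᵥ u = 1) (hv : v ⬝ᵥ v = 1) :
    u ⬝ᵥ v ≤ 1 := by
  have h : 0 ≤ (u - v) ⬝ᵥ (u - v) := Finset.sum_nonneg fun i _ => mul_self_nonneg _
  simp only [sub_dotProduct, dotProduct_sub, hu, hv, dotProduct_comm v u] at h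
  linarith

lemma card_pos_of_dotProduct_self_eq_one {u : m → ℝ} (hu : u ⬝ᵥ u = 1) : 0 < Fintype.card m := by
  by_contra h
  have := Fintype.card_eq_zero_iff.1 (Nat.eq_zero_of_not_pos h)
  simp [dotProduct] at hu

/-- Completing the square gives a bound free of `u` whose exponential factors over the coordinates
of `g`. -/
lemma dotProduct_le_of_pos {u : m → ℝ} (hu : u ⬝ᵥ u = 1) (g : m → ℝ) {c : ℝ} (hc : 0 < c) :
    u ⬝ᵥ g ≤ c / 2 + ∑ i, g i ^ 2 / (2 * c) := by
  have h : c / 2 = ∑ i, c / 2 * (u i * u i) := by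
    rw [← Finset.mul_sum]
    change _ = c / 2 * (u ⬝ᵥ u)
    rw [hu, mul_one]
  rw [h, ← Finset.sum_add_distrib]
  refine Finset.sum_le_sum fun i _ => ?_
  have : c / 2 * (u i * u i) + g i ^ 2 / (2 * c) - u i * g i = (c * u i - g i) ^ 2 / (2 * c) := by
    field_simp
    ring
  have : 0 ≤ (c * u i - g i) ^ 2 / (2 * c) := by positivity
  linarith

/-- The coefficients of the bilinear forms `uₖᵀ G vₖ`, perturbed by a common independent
standard Gaussian. -/
def bilinCoeff (u : κ → m → ℝ) (v : κ → n → ℝ) (k : κ) : (m × n) ⊕ (m ⊕ (n ⊕ Unit)) → ℝ :=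
  Sum.elim (fun q => u k q.1 * v k q.2) (Sum.elim 0 (Sum.elim 0 1))

/-- The coefficients of the linear forms `⟨g, uₖ⟩ + ⟨h, vₖ⟩`. -/
def addCoeff (u : κ → m → ℝ) (v : κ → n → ℝ) (k : κ) : (m × n) ⊕ (m ⊕ (n ⊕ Unit)) → ℝ :=
  Sum.elim 0 (Sum.elim (u k) (Sum.elim (v k) 0))

/-- The families occupy disjoint blocks of coordinates: this is the independence that the
interpolation needs. -/
lemma bilinCoeff_dotProduct_addCoeff (u : κ → m → ℝ) (v : κ → n → ℝ) (k l : κ) :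
    bilinCoeff u v k ⬝ᵥ addCoeff u v l = 0 := by
  simp [bilinCoeff, addCoeff, dotProduct]

lemma bilinCoeff_dotProduct_bilinCoeff (u : κ → m → ℝ) (v : κ → n → ℝ) (k l : κ) :
    bilinCoeff u v k ⬝ᵥ bilinCoeff u v l = (u k ⬝ᵥ u l) * (v k ⬝ᵥ v l) + 1 := by
  simp only [bilinCoeff, dotProduct, Fintype.sum_sum_type, Sum.elim_inl, Sum.elim_inr,
    Pi.zero_apply, mul_zero, Finset.sum_const_zero, Pi.one_apply, mul_one, zero_add,
    Fintype.sum_prod_type, Finset.sum_mul_sum]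
  congr 1
  · exact Finset.sum_congr rfl fun i _ => Finset.sum_congr rfl fun j _ => by ring
  · simp

lemma addCoeff_dotProduct_addCoeff (u : κ → m → ℝ) (v : κ → n → ℝ) (k l : κ) :
    addCoeff u v k ⬝ᵥ addCoeff u v l = (u k ⬝ᵥ u l) + (v k ⬝ᵥ v l) := by
  simp [addCoeff, dotProduct]

variable [Fintype κ]

lemma integral_expSum_bilinCoeff_rpow_le [Nonempty κ] {u : κ → m → ℝ} {v : κ → n → ℝ}
    (hu : ∀ k, u k ⬝ᵥ u k = 1) (hv : ∀ k, v k ⬝ᵥ v k = 1) {β p : ℝ} (hβ : 0 ≤ β) (hp0 : 0 ≤ p)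
    (hp1 : p ≤ 1) :
    ∫ z, expSum β (bilinCoeff u v) z ^ p ∂(Measure.pi fun _ => gaussianReal 0 1)
      ≤ ∫ z, expSum β (addCoeff u v) z ^ p ∂(Measure.pi fun _ => gaussianReal 0 1) := by
  refine integral_expSum_rpow_le hβ hp0 hp1 _ _ (bilinCoeff_dotProduct_addCoeff u v)
    (fun k => ?_) (fun k l => ?_)
  · rw [bilinCoeff_dotProduct_bilinCoeff, addCoeff_dotProduct_addCoeff, hu, hv, mul_one]
  · rw [bilinCoeff_dotProduct_bilinCoeff, addCoeff_dotProduct_addCoeff]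
    have h1 := dotProduct_le_of_dotProduct_self_eq_one (hu k) (hu l)
    have h2 := dotProduct_le_of_dotProduct_self_eq_one (hv k) (hv l)
    nlinarith [mul_nonneg (sub_nonneg.2 h1) (sub_nonneg.2 h2)]

/-- All the linear forms lie below one quadratic `B`, so the soft maximum is at most `N^p exp (λB)`,
whose expectation is a product of one-dimensional integrals. -/
lemma integral_expSum_addCoeff_rpow_le [Nonempty κ] {u : κ → m → ℝ} {v : κ → n → ℝ}
    (hu : ∀ k, u k ⬝ᵥ u k = 1) (hv : ∀ k, v k ⬝ᵥ v k = 1) {lam p : ℝ} (hl : 0 < lam) (hp0 : 0 < p) :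
    ∫ z, expSum (lam / p) (addCoeff u v) z ^ p ∂(Measure.pi fun _ => gaussianReal 0 1)
      ≤ (Fintype.card κ : ℝ) ^ p *
        Real.exp (lam * √(Fintype.card m) + lam * √(Fintype.card n) + lam ^ 2) := by
  have hm := card_pos_of_dotProduct_self_eq_one (hu (Classical.arbitrary κ))
  have hn := card_pos_of_dotProduct_self_eq_one (hv (Classical.arbitrary κ))
  obtain ⟨c, hc, hce⟩ := exists_exp_mul_sqrt_pow_le hl hm
  obtain ⟨c', hc', hce'⟩ := exists_exp_mul_sqrt_pow_le hl hn
  have hc0 := hl.trans hc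
  have hc0' := hl.trans hc'
  have hs : lam / (2 * c) < 1 / 2 := by rw [div_lt_div_iff₀ (by positivity) (by positivity)]; linarith
  have hs' : lam / (2 * c') < 1 / 2 := by
    rw [div_lt_div_iff₀ (by positivity) (by positivity)]; linarith
  set f : (m × n) ⊕ (m ⊕ (n ⊕ Unit)) → ℝ → ℝ :=
    Sum.elim (fun _ _ => 1) (Sum.elim (fun _ x => Real.exp (lam / (2 * c) * x ^ 2))
      (Sum.elim (fun _ x => Real.exp (lam / (2 * c') * x ^ 2)) (fun _ _ => 1))) with hf
  have hfi : ∀ i, Integrable (f i) (gaussianReal 0 1) := by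
    rintro (i | i | i | i)
    · exact integrable_const _
    · exact integrable_exp_mul_sq_gaussianReal hs
    · exact integrable_exp_mul_sq_gaussianReal hs'
    · exact integrable_const _
  have hprod : Integrable (fun z : (m × n) ⊕ (m ⊕ (n ⊕ Unit)) → ℝ => ∏ i, f i (z i))
      (Measure.pi fun _ => gaussianReal 0 1) := Integrable.fintype_prod hfi
  calc ∫ z, expSum (lam / p) (addCoeff u v) z ^ p ∂(Measure.pi fun _ => gaussianReal 0 1)
      ≤ ∫ z, ((Fintype.card κ : ℝ) ^ p * (Real.exp (lam * c / 2) * Real.exp (lam * c' / 2))) *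
          ∏ i, f i (z i) ∂(Measure.pi fun _ => gaussianReal 0 1) := by
        refine integral_mono_of_nonneg (Filter.Eventually.of_forall fun z =>
          Real.rpow_nonneg (expSum_pos _ _ z).le _) (hprod.const_mul _)
          (Filter.Eventually.of_forall fun z => ?_)
        set B : ℝ := (c / 2 + ∑ i, z (.inr (.inl i)) ^ 2 / (2 * c)) +
          (c' / 2 + ∑ j, z (.inr (.inr (.inl j))) ^ 2 / (2 * c')) with hB
        have hle : expSum (lam / p) (addCoeff u v) z
            ≤ Fintype.card κ * Real.exp (lam / p * B) := by
          rw [← nsmul_eq_mul, ← Finset.card_univ]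
          refine Finset.sum_le_card_nsmul _ _ _ fun k _ => ?_
          rw [Real.exp_le_exp]
          refine mul_le_mul_of_nonneg_left ?_ (by positivity)
          have h1 := dotProduct_le_of_pos (hu k) (fun i => z (.inr (.inl i))) hc0
          have h2 := dotProduct_le_of_pos (hv k) (fun j => z (.inr (.inr (.inl j)))) hc0'
          have h3 : addCoeff u v k ⬝ᵥ z = (u k ⬝ᵥ fun i => z (.inr (.inl i))) +
              (v k ⬝ᵥ fun j => z (.inr (.inr (.inl j)))) := by
            simp [addCoeff, dotProduct]
          rw [h3]
          exact add_le_add h1 h2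
        refine (Real.rpow_le_rpow (expSum_pos _ _ z).le hle hp0.le).trans (le_of_eq ?_)
        beta_reduce
        rw [Real.mul_rpow (Nat.cast_nonneg _) (Real.exp_pos _).le, ← Real.exp_mul,
          mul_assoc ((Fintype.card κ : ℝ) ^ p)]
        congr 1
        simp only [hf, Fintype.prod_sum_type, Sum.elim_inl, Sum.elim_inr, Finset.prod_const_one,
          one_mul, mul_one, ← Real.exp_sum, ← Real.exp_add]
        congr 1
        rw [hB, div_mul_eq_mul_div, div_mul_cancel₀ _ hp0.ne', mul_add, mul_add, mul_add,
          Finset.mul_sum, Finset.mul_sum]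
        have h5 : ∀ x d : ℝ, lam * (x ^ 2 / (2 * d)) = lam / (2 * d) * x ^ 2 := fun x d => by ring
        simp only [h5]
        ring
    _ = (Fintype.card κ : ℝ) ^ p *
        ((Real.exp (lam * c / 2) * √(1 / (1 - 2 * (lam / (2 * c)))) ^ Fintype.card m) *
        (Real.exp (lam * c' / 2) * √(1 / (1 - 2 * (lam / (2 * c')))) ^ Fintype.card n)) := by
        rw [integral_const_mul, integral_fintype_prod_eq_prod]
        simp only [hf, Fintype.prod_sum_type, Sum.elim_inl, Sum.elim_inr,
          integral_exp_mul_sq_gaussianReal hs, integral_exp_mul_sq_gaussianReal hs']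
        simp
        ring
    _ ≤ _ := by
        refine mul_le_mul_of_nonneg_left ((mul_le_mul hce hce' (by positivity)
          (Real.exp_pos _).le).trans (le_of_eq ?_)) (by positivity)
        rw [← Real.exp_add]
        congr 1
        ring

end Bilinear

/-! ### Chernoff bound for suprema of bilinear forms -/

section Tail

variable {m n κ : Type*} [Fintype m] [Fintype n]

lemma measurePreserving_comp_pi {ι ι' : Type*} [Fintype ι] [Fintype ι'] (ν : Measure ℝ)
    [IsProbabilityMeasure ν] {e : ι' → ι} (he : Function.Injective e) :
    MeasurePreserving (fun (z : ι → ℝ) (i : ι') => z (e i)) (Measure.pi fun _ : ι => ν)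
      (Measure.pi fun _ : ι' => ν) := by
  refine ⟨by fun_prop, ?_⟩
  have h := (iIndepFun_pi (μ := fun _ : ι => ν) (X := fun _ => id)
    (fun _ => aemeasurable_id)).precomp he
  exact (h.hasLaw_pi (μ := fun _ : ι' => ν)
    fun i => (measurePreserving_eval (fun _ : ι => ν) (e i)).hasLaw).map_eq

/-- The event ignores coordinate `i`, so resampling that coordinate splits off its moment generating
function. It is applied to the auxiliary variable `γ`. -/
lemma integral_indicator_exp_eval_pi {ι : Type*} [Fintype ι] [DecidableEq ι] (i : ι) (t : ℝ)
    {E : Set (ι → ℝ)} (hE : MeasurableSet E) (hEi : ∀ z x, Function.update z i x ∈ E ↔ z ∈ E) :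
    ∫ z, E.indicator (fun z => Real.exp (t * z i)) z ∂(Measure.pi fun _ => gaussianReal 0 1)
      = (Measure.pi fun _ => gaussianReal 0 1).real E * Real.exp (t ^ 2 / 2) := by
  classical
  have hi : Integrable (fun z : ι → ℝ => Real.exp (t * z i))
      (Measure.pi fun _ => gaussianReal 0 1) :=
    ((measurePreserving_eval (fun _ : ι => gaussianReal 0 1) i).integrable_comp_of_integrable
      (integrable_exp_mul_gaussianReal t))
  rw [integral_pi_eq_integral_integral_update _ i (hi.indicator hE)]
  have h : ∀ z : ι → ℝ, ∫ x, E.indicator (fun z => Real.exp (t * z i)) (Function.update z i x)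
      ∂(gaussianReal 0 1) = E.indicator (fun _ => Real.exp (t ^ 2 / 2)) z := fun z => by
    by_cases hz : z ∈ E
    · simp only [Set.indicator, hEi, hz, if_true, Function.update_self]
      have := congrFun (mgf_id_gaussianReal (μ := 0) (v := 1)) t
      simpa [mgf] using this
    · simp [Set.indicator, hEi, hz]
  simp only [h]
  rw [integral_indicator_const _ hE, smul_eq_mul]

lemma expSum_bilinCoeff_rpow_ge [Fintype κ] (u : κ → m → ℝ) (v : κ → n → ℝ) {lam p : ℝ}
    (hp0 : 0 < p) (z : (m × n) ⊕ (m ⊕ (n ⊕ Unit)) → ℝ) (k : κ) :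
    Real.exp (lam * (∑ q : m × n, u k q.1 * v k q.2 * z (.inl q))) *
      Real.exp (lam * z (.inr (.inr (.inr ())))) ≤ expSum (lam / p) (bilinCoeff u v) z ^ p := by
  refine le_trans (le_of_eq ?_)
    (Real.rpow_le_rpow (Real.exp_pos _).le (exp_le_expSum (lam / p) (bilinCoeff u v) z k) hp0.le)
  rw [← Real.exp_mul, ← Real.exp_add]
  congr 1
  have h : bilinCoeff u v k ⬝ᵥ z
      = (∑ q : m × n, u k q.1 * v k q.2 * z (.inl q)) + z (.inr (.inr (.inr ()))) := by
    simp [bilinCoeff, dotProduct]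
  rw [h]
  field_simp

lemma measureReal_exists_lt_bilin_le [Fintype κ] [Nonempty κ] {u : κ → m → ℝ} {v : κ → n → ℝ}
    (hu : ∀ k, u k ⬝ᵥ u k = 1) (hv : ∀ k, v k ⬝ᵥ v k = 1) {t : ℝ} (ht : 0 < t) :
    (Measure.pi fun _ : m × n => gaussianReal 0 1).real
      {A | ∃ k, √(Fintype.card m) + √(Fintype.card n) + t < ∑ q, u k q.1 * v k q.2 * A q}
      ≤ Real.exp (-t ^ 2 / 2) := by
  classical
  set s : ℝ := √(Fintype.card m) + √(Fintype.card n) + t with hs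
  set E : Set (m × n → ℝ) := {A | ∃ k, s < ∑ q, u k q.1 * v k q.2 * A q} with hE
  have hEm : MeasurableSet E := by
    have : E = ⋃ k, {A | s < ∑ q, u k q.1 * v k q.2 * A q} := by ext A; simp [hE]
    rw [this]
    exact MeasurableSet.iUnion fun k => measurableSet_lt measurable_const (by fun_prop)
  have hmp := measurePreserving_comp_pi (gaussianReal 0 1)
    (e := (Sum.inl : m × n → (m × n) ⊕ (m ⊕ (n ⊕ Unit)))) Sum.inl_injective
  set E' := (fun (z : (m × n) ⊕ (m ⊕ (n ⊕ Unit)) → ℝ) (q : m × n) => z (.inl q)) ⁻¹' E with hE'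
  have hreal : (Measure.pi fun _ : m × n => gaussianReal 0 1).real E
      = (Measure.pi fun _ : (m × n) ⊕ (m ⊕ (n ⊕ Unit)) => gaussianReal 0 1).real E' := by
    rw [measureReal_def, measureReal_def, hmp.measure_preimage hEm.nullMeasurableSet]
  have hE'm : MeasurableSet E' := hmp.measurable hEm
  set P' := (Measure.pi fun _ : (m × n) ⊕ (m ⊕ (n ⊕ Unit)) => gaussianReal 0 1).real E' with hP'
  have hmain : ∀ p : ℝ, 0 < p → p ≤ 1 → Real.exp (t * s) * (P' * Real.exp (t ^ 2 / 2))
      ≤ (Fintype.card κ : ℝ) ^ p *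
        Real.exp (t * √(Fintype.card m) + t * √(Fintype.card n) + t ^ 2) := by
    intro p hp0 hp1
    have hβ : 0 ≤ t / p := (div_pos ht hp0).le
    refine le_trans ?_ ((integral_expSum_bilinCoeff_rpow_le hu hv hβ hp0.le hp1).trans
      (integral_expSum_addCoeff_rpow_le hu hv ht hp0))
    rw [← integral_indicator_exp_eval_pi (.inr (.inr (.inr ()))) t hE'm
      (fun z x => by simp [hE', hE]), ← integral_const_mul]
    refine integral_mono_of_nonneg (Filter.Eventually.of_forall fun z => mul_nonneg
      (Real.exp_pos _).le (Set.indicator_nonneg (fun _ _ => (Real.exp_pos _).le) _))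
      (integrable_expSum_rpow _ hβ hp0.le hp1) (Filter.Eventually.of_forall fun z => ?_)
    by_cases hz : z ∈ E'
    · obtain ⟨k, hk⟩ := id hz
      simp only [Set.indicator_of_mem hz]
      refine le_trans (mul_le_mul_of_nonneg_right ?_ (Real.exp_pos _).le)
        (expSum_bilinCoeff_rpow_ge u v hp0 z k)
      exact Real.exp_le_exp.2 (mul_le_mul_of_nonneg_left hk.le ht.le)
    · simp only [Set.indicator_of_notMem hz, mul_zero]
      exact Real.rpow_nonneg (expSum_pos _ _ z).le _
  -- Letting `p → 0⁺` sends the cardinality factor to 1; the left side of `hmain` does not depend on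
  -- `p`.
  have hlim : Filter.Tendsto (fun p : ℝ => (Fintype.card κ : ℝ) ^ p *
      Real.exp (t * √(Fintype.card m) + t * √(Fintype.card n) + t ^ 2)) (nhdsWithin 0 (Set.Ioi 0))
      (nhds ((Fintype.card κ : ℝ) ^ (0 : ℝ) *
        Real.exp (t * √(Fintype.card m) + t * √(Fintype.card n) + t ^ 2))) := by
    refine (Filter.Tendsto.mul_const _ ?_).mono_left nhdsWithin_le_nhds
    exact (Real.continuous_const_rpow (Nat.cast_ne_zero.2 Fintype.card_ne_zero)).tendsto 0
  have hfin := ge_of_tendsto hlim (b := Real.exp (t * s) * (P' * Real.exp (t ^ 2 / 2))) <| by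
    filter_upwards [Ioc_mem_nhdsGT (zero_lt_one' ℝ)] with p hp using hmain p hp.1 hp.2
  rw [Real.rpow_zero, one_mul] at hfin
  rw [hreal]
  have h1 : Real.exp (t * s) * (P' * Real.exp (t ^ 2 / 2)) = Real.exp (t * s + t ^ 2 / 2) * P' := by
    rw [Real.exp_add]; ring
  have h2 : Real.exp (t * √(Fintype.card m) + t * √(Fintype.card n) + t ^ 2)
      = Real.exp (t * s + t ^ 2 / 2) * Real.exp (-t ^ 2 / 2) := by
    rw [← Real.exp_add]; congr 1; rw [hs]; ring
  rw [h1, h2] at hfin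
  exact le_of_mul_le_mul_left hfin (Real.exp_pos _)

/-- The finite bound does not involve the number of forms, so it survives the directed union over
finite subfamilies. -/
lemma measureReal_exists_lt_bilin_le_of_countable [Countable κ] {u : κ → m → ℝ} {v : κ → n → ℝ}
    (hu : ∀ k, u k ⬝ᵥ u k = 1) (hv : ∀ k, v k ⬝ᵥ v k = 1) {t : ℝ} (ht : 0 < t) :
    (Measure.pi fun _ : m × n => gaussianReal 0 1).real
      {A | ∃ k, √(Fintype.card m) + √(Fintype.card n) + t < ∑ q, u k q.1 * v k q.2 * A q}
      ≤ Real.exp (-t ^ 2 / 2) := by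
  set s : ℝ := √(Fintype.card m) + √(Fintype.card n) + t with hs
  set S : Finset κ → Set (m × n → ℝ) := fun T => {A | ∃ k ∈ T, s < ∑ q, u k q.1 * v k q.2 * A q}
    with hS
  have hU : {A : m × n → ℝ | ∃ k, s < ∑ q, u k q.1 * v k q.2 * A q} = ⋃ T, S T := by
    ext A
    simp only [hS, Set.mem_ofPred_eq, Set.mem_iUnion]
    exact ⟨fun ⟨k, hk⟩ => ⟨{k}, k, by simp, hk⟩, fun ⟨_, k, _, hk⟩ => ⟨k, hk⟩⟩
  have hmono : Monotone S := fun T T' h A ⟨k, hk, hA⟩ => ⟨k, h hk, hA⟩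
  rw [hU, measureReal_def, hmono.directed_le.measure_iUnion]
  refine ENNReal.toReal_le_of_le_ofReal (Real.exp_pos _).le (iSup_le fun T => ?_)
  rcases T.eq_empty_or_nonempty with rfl | hT
  · simp [hS]
  · have : Nonempty T := hT.to_subtype
    have h := measureReal_exists_lt_bilin_le (u := fun k : T => u k) (v := fun k : T => v k)
      (fun k => hu k) (fun k => hv k) ht
    have hST : S T = {A | ∃ k : T, s < ∑ q, u k q.1 * v k q.2 * A q} := by
      ext A; simp [hS]
    rw [hST]
    exact (ENNReal.le_ofReal_iff_toReal_le (measure_ne_top _ _) (Real.exp_pos _).le).2 h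

end Tail

/-! ### From bilinear forms to the operator norm -/

section OperatorNorm

variable {m n : Type*} [Fintype m] [Fintype n] [DecidableEq n]

/-- Take `v` a unit vector with `r < ‖Av‖` and `u = Av / ‖Av‖`. -/
lemma exists_lt_bilin_of_lt_l2_opNorm (A : Matrix m n ℝ) {r : ℝ} (hr0 : 0 ≤ r) (hr : r < ‖A‖) :
    ∃ u : m → ℝ, ∃ v : n → ℝ, u ⬝ᵥ u = 1 ∧ v ⬝ᵥ v = 1 ∧ r < ∑ q : m × n, u q.1 * v q.2 * A q.1 q.2 := by
  rw [Matrix.l2_opNorm_def] at hr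
  obtain ⟨x, hx, hrx⟩ := ContinuousLinearMap.exists_nnnorm_eq_one_lt_apply_of_lt_opNNNorm
    _ (r := ⟨r, hr0⟩) hr
  set y := ((Matrix.toEuclideanLin (𝕜 := ℝ) (m := m) (n := n)).trans
    LinearMap.toContinuousLinearMap A) x with hy
  have hry : r < ‖y‖ := hrx
  have hy0 : 0 < ‖y‖ := hr0.trans_lt hry
  have hyy : y.ofLp ⬝ᵥ y.ofLp = ‖y‖ ^ 2 := by
    rw [EuclideanSpace.real_norm_sq_eq]
    exact Finset.sum_congr rfl fun i _ => (sq _).symm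
  have hxx : x.ofLp ⬝ᵥ x.ofLp = 1 := by
    have : ‖x‖ = 1 := congrArg NNReal.toReal hx
    rw [← one_pow 2, ← this, EuclideanSpace.real_norm_sq_eq]
    exact Finset.sum_congr rfl fun i _ => (sq _).symm
  refine ⟨‖y‖⁻¹ • y.ofLp, x.ofLp, ?_, hxx, ?_⟩
  · rw [smul_dotProduct, dotProduct_smul, hyy, smul_eq_mul, smul_eq_mul]
    field_simp
  · have hyA : ∀ i, y.ofLp i = ∑ j, A i j * x.ofLp j := fun i => rfl
    have h : ∑ q : m × n, (‖y‖⁻¹ • y.ofLp) q.1 * x.ofLp q.2 * A q.1 q.2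
        = (‖y‖⁻¹ • y.ofLp) ⬝ᵥ y.ofLp := by
      rw [Fintype.sum_prod_type, dotProduct]
      refine Finset.sum_congr rfl fun i _ => ?_
      rw [hyA i, Finset.mul_sum]
      exact Finset.sum_congr rfl fun j _ => by ring
    rw [h, smul_dotProduct, hyy, smul_eq_mul]
    have : ‖y‖⁻¹ * ‖y‖ ^ 2 = ‖y‖ := by field_simp
    rwa [this]

/-- The Davidson–Szarek bound for the largest singular value of a standard Gaussian matrix. -/
theorem measureReal_lt_l2_opNorm_le {t : ℝ} (ht : 0 < t) :
    (Measure.pi fun _ : m × n => gaussianReal 0 1).real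
      {A | √(Fintype.card m) + √(Fintype.card n) + t < ‖Matrix.of fun i j => A (i, j)‖}
      ≤ Real.exp (-t ^ 2 / 2) := by
  -- The strict inequality is an open condition on the pair, so a countable dense set of pairs
  -- already witnesses it.
  let W := {w : (m → ℝ) × (n → ℝ) // w.1 ⬝ᵥ w.1 = 1 ∧ w.2 ⬝ᵥ w.2 = 1}
  obtain ⟨D, hDc, hDd⟩ := TopologicalSpace.exists_countable_dense W
  have : Countable D := hDc.to_subtype
  refine (measureReal_mono fun A hA => ?_).trans
    (measureReal_exists_lt_bilin_le_of_countable (κ := D) (u := fun w => w.1.1.1)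
      (v := fun w => w.1.1.2) (fun w => w.1.2.1) (fun w => w.1.2.2) ht)
  obtain ⟨u, v, hu, hv, h⟩ := exists_lt_bilin_of_lt_l2_opNorm _ (by positivity) hA
  have hopen : IsOpen {w : W | √(Fintype.card m) + √(Fintype.card n) + t
      < ∑ q : m × n, w.1.1 q.1 * w.1.2 q.2 * A q} :=
    isOpen_lt continuous_const (by fun_prop)
  obtain ⟨w, hw, hwD⟩ := hDd.inter_open_nonempty _ hopen ⟨⟨(u, v), hu, hv⟩, h⟩
  exact ⟨⟨w, hwD⟩, hw⟩

end OperatorNorm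

/-! ### Reduction of the sample covariance to a standard Gaussian matrix -/

section SampleCovariance

variable {n d : ℕ}

/-- The matrix of the orthogonal projection that subtracts the mean from a vector. -/
noncomputable def centeringMatrix (n : ℕ) : Matrix (Fin n) (Fin n) ℝ :=
  1 - (1 / (n : ℝ)) • Matrix.of fun _ _ => 1

lemma isStarProjection_centeringMatrix (hn : 0 < n) : IsStarProjection (centeringMatrix n) := by
  have hn' : (n : ℝ) ≠ 0 := by exact_mod_cast hn.ne'
  have h : IsStarProjection ((1 / (n : ℝ)) • Matrix.of fun _ _ => 1 : Matrix (Fin n) (Fin n) ℝ) := by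
    refine ⟨?_, ?_⟩
    · ext i j
      simp [Matrix.mul_apply, hn']
    · ext i j
      simp [Matrix.star_apply]
  exact h.one_sub

/-- Centring annihilates a matrix with all rows equal, so any `μ` may be subtracted first. -/
lemma centeredData_eq_centeringMatrix_mul (hn : 0 < n) (X : Matrix (Fin n) (Fin d) ℝ)
    (μ : Fin d → ℝ) :
    centeredData X = centeringMatrix n * Matrix.of fun i j => X i j - μ j := by
  have hn' : (n : ℝ) ≠ 0 := by exact_mod_cast hn.ne'
  ext i j
  rw [centeringMatrix, Matrix.sub_mul, Matrix.one_mul, Matrix.smul_mul]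
  simp only [centeredData, sampleMean, Matrix.sub_apply, Matrix.smul_apply, Matrix.mul_apply,
    Matrix.of_apply, smul_eq_mul, one_mul, Finset.sum_sub_distrib, Finset.sum_const,
    Finset.card_univ, Fintype.card_fin, nsmul_eq_mul]
  field_simp
  ring

lemma norm_sampleCovariance_le (hn : 0 < n) (X : Matrix (Fin n) (Fin d) ℝ) (μ : Fin d → ℝ) :
    ‖sampleCovariance X‖ ≤ 1 / n * ‖Matrix.of fun i j => X i j - μ j‖ ^ 2 := by
  rw [sampleCovariance, norm_smul, Real.norm_of_nonneg (by positivity),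
    ← Matrix.conjTranspose_eq_transpose_of_trivial, Matrix.l2_opNorm_conjTranspose_mul_self, ← sq]
  gcongr
  rw [centeredData_eq_centeringMatrix_mul hn X μ]
  refine (Matrix.l2_opNorm_mul _ _).trans (mul_le_of_le_one_left (norm_nonneg _) ?_)
  exact (isStarProjection_centeringMatrix hn).norm_le

lemma map_sub_multivariateGaussian_one (μ : EuclideanSpace ℝ (Fin d)) :
    (multivariateGaussian μ (1 : Matrix (Fin d) (Fin d) ℝ)).map (fun x j => x j - μ j)
      = Measure.pi fun _ => gaussianReal 0 1 := by
  rw [multivariateGaussian, ← map_pi_eq_stdGaussian, Measure.map_map (by fun_prop) (by fun_prop),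
    Measure.map_map (by fun_prop) (by fun_prop)]
  -- With identity covariance, the affine map defining the Gaussian is translation by `μ`, which the
  -- subtraction undoes.
  convert Measure.map_id
  ext x j
  simp

lemma map_uncurry_pi_pi {m n : Type*} [Fintype m] [Fintype n] (ν : Measure ℝ)
    [IsProbabilityMeasure ν] :
    (Measure.pi fun _ : m => Measure.pi fun _ : n => ν).map (fun A (q : m × n) => A q.1 q.2)
      = Measure.pi fun _ => ν := by
  refine (Measure.pi_eq fun s hs => ?_).symm
  rw [Measure.map_apply (by fun_prop) (MeasurableSet.univ_pi hs)]
  have h : (fun (A : m → n → ℝ) (q : m × n) => A q.1 q.2) ⁻¹' Set.univ.pi s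
      = Set.univ.pi fun i => Set.univ.pi fun j => s (i, j) := by
    ext A
    simp [Set.mem_pi]
  rw [h, Measure.pi_pi]
  simp only [Measure.pi_pi, Fintype.prod_prod_type]

lemma hasLaw_entries_sub_mean {Ω : Type*} [MeasurableSpace Ω] {P : Measure Ω}
    {μ : EuclideanSpace ℝ (Fin d)} {X : Ω → Matrix (Fin n) (Fin d) ℝ}
    (hlaw : ∀ i : Fin n, HasLaw (fun ω => WithLp.toLp 2 (X ω i))
      (multivariateGaussian μ (1 : Matrix (Fin d) (Fin d) ℝ)) P)
    (hindep : iIndepFun (fun (i : Fin n) (ω : Ω) => WithLp.toLp 2 (X ω i)) P) :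
    HasLaw (fun ω (q : Fin n × Fin d) => X ω q.1 q.2 - μ q.2)
      (Measure.pi fun _ => gaussianReal 0 1) P := by
  have hrow : HasLaw (fun (x : EuclideanSpace ℝ (Fin d)) j => x j - μ j)
      (Measure.pi fun _ => gaussianReal 0 1) (multivariateGaussian μ 1) :=
    ⟨by fun_prop, map_sub_multivariateGaussian_one μ⟩
  have hi := hindep.comp (fun _ x j => x j - μ j) (fun _ => by fun_prop)
  have hpi := hi.hasLaw_pi fun i => hrow.comp (hlaw i)
  have hun : HasLaw (fun (A : Fin n → Fin d → ℝ) (q : Fin n × Fin d) => A q.1 q.2)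
      (Measure.pi fun _ => gaussianReal 0 1)
      (Measure.pi fun _ => Measure.pi fun _ => gaussianReal 0 1) :=
    ⟨(show Measurable _ by fun_prop).aemeasurable, map_uncurry_pi_pi _⟩
  exact hun.comp hpi

/-- The left side is the square of the first three summands; the fourth is nonnegative. -/
lemma sq_div_le_sq_one_add (hn : 0 < n) {t : ℝ} (ht : 0 < t) :
    1 / (n : ℝ) * (√n + √d + t) ^ 2 ≤
      (1 + √((d : ℝ) / n) + t / √n + √(d + √(2 * d) * t + t ^ 2) / n) ^ 2 := by
  have hn' : (0 : ℝ) < √n := Real.sqrt_pos.2 (by exact_mod_cast hn)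
  have h : 1 / (n : ℝ) * (√n + √d + t) ^ 2 = (1 + √((d : ℝ) / n) + t / √n) ^ 2 := by
    rw [Real.sqrt_div (Nat.cast_nonneg d)]
    nth_rewrite 1 [← Real.sq_sqrt (Nat.cast_nonneg n)]
    field_simp
  rw [h]
  refine pow_le_pow_left₀ (by positivity) (le_add_of_nonneg_right (by positivity)) 2

end SampleCovariance

/-- `‖·‖` is the operator norm of a matrix with respect to the Euclidean norms (the spectral
norm), from the scope `Matrix.Norms.L2Operator`. -/
theorem theorem1 {Ω : Type*} [MeasurableSpace Ω] (P : Measure Ω) [IsProbabilityMeasure P]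
    (n d : ℕ) (hn : 0 < n) (μ : EuclideanSpace ℝ (Fin d))
    (X : Ω → Matrix (Fin n) (Fin d) ℝ)
    (hlaw : ∀ i : Fin n, HasLaw (fun ω => WithLp.toLp 2 (X ω i))
      (multivariateGaussian μ (1 : Matrix (Fin d) (Fin d) ℝ)) P)
    (hindep : iIndepFun (fun (i : Fin n) (ω : Ω) => WithLp.toLp 2 (X ω i)) P)
    (t : ℝ) (ht : 0 < t) :
    1 - 3 * Real.exp (-t ^ 2 / 2) ≤
      P.real {ω | ‖sampleCovariance (X ω)‖ ≤
        (1 + Real.sqrt ((d : ℝ) / n) + t / Real.sqrt n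
          + Real.sqrt (d + Real.sqrt (2 * d) * t + t ^ 2) / n) ^ 2} := by
  have hG := hasLaw_entries_sub_mean hlaw hindep
  set S := {ω | ‖sampleCovariance (X ω)‖ ≤
        (1 + Real.sqrt ((d : ℝ) / n) + t / Real.sqrt n
          + Real.sqrt (d + Real.sqrt (2 * d) * t + t ^ 2) / n) ^ 2} with hS
  set B := {A : Fin n × Fin d → ℝ | √(Fintype.card (Fin n)) + √(Fintype.card (Fin d)) + t
    < ‖Matrix.of fun i j => A (i, j)‖} with hB
  have hsub : Sᶜ ⊆ (fun ω (q : Fin n × Fin d) => X ω q.1 q.2 - μ q.2) ⁻¹' B := by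
    intro ω hω
    by_contra hωB
    refine hω ((norm_sampleCovariance_le hn (X ω) μ).trans
      (le_trans ?_ (sq_div_le_sq_one_add hn ht)))
    simp only [hB, Set.mem_preimage, Set.mem_ofPred_eq, not_lt, Fintype.card_fin] at hωB
    gcongr
  have hBm : MeasurableSet B := measurableSet_lt measurable_const
    (Continuous.measurable (by
      refine continuous_norm.comp (continuous_matrix fun i j => continuous_apply (i, j))))
  have hPB : P.real ((fun ω (q : Fin n × Fin d) => X ω q.1 q.2 - μ q.2) ⁻¹' B)
      ≤ Real.exp (-t ^ 2 / 2) := by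
    rw [measureReal_def, ← Measure.map_apply_of_aemeasurable hG.aemeasurable hBm, hG.map_eq]
    exact measureReal_lt_l2_opNorm_le ht
  have h1 : P.real Sᶜ ≤ Real.exp (-t ^ 2 / 2) := (measureReal_mono hsub).trans hPB
  -- Subadditivity suffices here, so measurability of `S` is not needed.
  have h2 : 1 ≤ P.real S + P.real Sᶜ := by
    have := measureReal_union_le (μ := P) S Sᶜ
    rwa [Set.union_compl_self, probReal_univ] at this
  linarith [Real.exp_pos (-t ^ 2 / 2)]
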